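/- Let $\mathcal X$ be a complex Hilbert space, let $\mathcal P_0,\mathcal S_0$ be densely defined linear operators in $\mathcal X$ with adjoints $\mathcal P=\mathcal P_0^*$, $\mathcal S=\mathcal S_0^*$, and let $B=\left[\begin{smallmatrix}\mathcal P\\ \mathcal S\end{smallmatrix}\right]$ be the operator $Bx=(\mathcal Px,\mathcal Sx)$ from $\operatorname{dom}B=\operatorname{dom}\mathcal P\cap\operatorname{dom}\mathcal S\subset\mathcal X$ to $\mathcal X\times\mathcal X$. Assume that $B$ is coercive: there is $c>0$ with $\|Bx\|_{\mathcal X\times\mathcal X}\ge c\|x\|_{\mathcal X}$ for all $x\in\operatorname{dom}B$, where $\|(u,v)\|_{\mathcal X\times\mathcal X}^2=\|u\|^2+\|v\|^2$. A linear relation in a Hilbert space $\mathcal Y$ is a linear subspace $K\subset\mathcal Y\times\mathcal Y$; its adjoint is $K^*=\{(g_1,g_2)\in\mathcal Y\times\mathcal Y : \langle g_2,h_1\rangle=\langle g_1,h_2\rangle \text{ for all } (h_1,h_2)\in K\}$. Put $H=\{(f_1,f_2)\in\operatorname{dom}\mathcal S_0\times\operatorname{dom}\mathcal P_0 : \mathcal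 S_0f_1=\mathcal P_0f_2\}$ and assume $H\subset H^*$. Let $(\mathcal G,\Gamma_0,\Gamma_1)$ be a boundary triplet for $\operatorname{ran}B$, that is, $\mathcal G$ is a complex Hilbert space and $\Gamma=(\Gamma_0,\Gamma_1):\operatorname{dom}B\to\mathcal G\times\mathcal G$ is linear and surjective with $$\langle\mathcal Sx,\mathcal Py\rangle-\langle\mathcal Px,\mathcal Sy\rangle=\langle\Gamma_1x,\Gamma_0y\rangle-\langle\Gamma_0x,\Gamma_1y\rangle\qquad (x,y\in\operatorname{dom}B).$$ For a linear relation $\Theta$ in $\mathcal G$ let $A_\Theta$ be the restriction of $B$ to $\operatorname{dom}A_\Theta=\{x\in\operatorname{dom}B : \Gamma x\in\Theta\}$. Then the following holds. (i) Let $A$ be a linear operator from $\operatorname{dom}A\subset\mathcal X$ to $\mathcal X\times\mathcal X$ with $\operatorname{ran}B|_{\ker\Gamma}\subset\operatorname{ran}A\subset\operatorname{ran}B$. Then there is a unique linear relation $\Theta$ in $\mathcal G$ with $\operatorname{ran}A=\operatorname{ran}A_\Theta$; if moreover $A$ is a restriction of $B$, then there is a unique linear relation $\Theta$ in $\mathcal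 G$ with $A=A_\Theta$. (ii) $\overline{\operatorname{ran}A_\Theta}=\operatorname{ran}A_{\overline\Theta}$ for every linear relation $\Theta$ in $\mathcal G$. (iii) If $H^*=\operatorname{ran}B$, then $(\operatorname{ran}A_\Theta)^*=\operatorname{ran}A_{\Theta^*}$ for every linear relation $\Theta$ in $\mathcal G$. (iv) For linear relations $\Theta,\Theta'$ in $\mathcal G$, $\operatorname{ran}A_\Theta\subset\operatorname{ran}A_{\Theta'}$ if and only if $\Theta\subset\Theta'$. -/

import Mathlib

noncomputable section

namespace RangeTriplet

variable {X : Type*} [NormedAddCommGroup X] [InnerProductSpace ℂ X]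
variable {G : Type*} [NormedAddCommGroup G] [InnerProductSpace ℂ G]

/-- The range of a partially defined linear operator, as a linear subspace. -/
def ran {E F : Type*} [AddCommGroup E] [Module ℂ E] [AddCommGroup F] [Module ℂ F]
    (A : E →ₗ.[ℂ] F) : Submodule ℂ F :=
  LinearMap.range A.toFun

/-- The restriction of a partially defined operator `A` to a linear subspace `D` of its domain. -/
def restrict {E F : Type*} [AddCommGroup E] [Module ℂ E] [AddCommGroup F] [Module ℂ F]
    (A : E →ₗ.[ℂ] F) (D : Submodule ℂ A.domain) : E →ₗ.[ℂ] F where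
  domain := D.map A.domain.subtype
  toFun := A.toFun ∘ₗ Submodule.inclusion (Submodule.map_subtype_le A.domain D)

/-- The column operator `x ↦ (P x, S x)` with domain `dom P ∩ dom S`. -/
def column (P S : X →ₗ.[ℂ] X) : X →ₗ.[ℂ] (X × X) where
  domain := P.domain ⊓ S.domain
  toFun := (P.toFun ∘ₗ Submodule.inclusion inf_le_left).prod
    (S.toFun ∘ₗ Submodule.inclusion inf_le_right)

/-- Coercivity of an operator into `X × X`, the product carrying its Hilbert space norm
`‖(u, v)‖² = ‖u‖² + ‖v‖²`. -/
def Coercive (B : X →ₗ.[ℂ] (X × X)) : Prop :=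
  ∃ c : ℝ, 0 < c ∧ ∀ x : B.domain, c * ‖(x : X)‖ ≤ ‖WithLp.toLp 2 (B x)‖

/-- The linear relation `(gr P₀)⁻¹ (gr S₀)`, that is, all pairs `(f₁, f₂)` in
`dom S₀ × dom P₀` with `S₀ f₁ = P₀ f₂`. -/
def kernelRelation (P₀ S₀ : X →ₗ.[ℂ] X) : Submodule ℂ (X × X) where
  carrier := {f | ∃ (f₁ : S₀.domain) (f₂ : P₀.domain), f = ((f₁ : X), (f₂ : X)) ∧ S₀ f₁ = P₀ f₂}
  zero_mem' := ⟨0, 0, rfl, by simp⟩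
  add_mem' := by
    rintro _ _ ⟨a, b, rfl, h⟩ ⟨a', b', rfl, h'⟩
    exact ⟨a + a', b + b', by simp, by simp [LinearPMap.map_add, h, h']⟩
  smul_mem' := by
    rintro c _ ⟨a, b, rfl, h⟩
    exact ⟨c • a, c • b, by simp, by simp [LinearPMap.map_smul, h]⟩

/-- `(G, Γ₀, Γ₁)` is a boundary triplet for `ran B`, where `B x = (P x, S x)`: the map
`Γ = (Γ₀, Γ₁)` is linear and onto `G × G`, and the abstract Green identity
`⟪S x, P y⟫ - ⟪P x, S y⟫ = ⟪Γ₁ x, Γ₀ y⟫ - ⟪Γ₀ x, Γ₁ y⟫` holds on `dom B`. -/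
structure IsBoundaryTriplet (B : X →ₗ.[ℂ] (X × X)) (Γ₀ Γ₁ : B.domain →ₗ[ℂ] G) : Prop where
  surjective : Function.Surjective (Γ₀.prod Γ₁)
  green : ∀ x y : B.domain,
    inner ℂ (B x).2 (B y).1 - inner ℂ (B x).1 (B y).2 =
      inner ℂ (Γ₁ x) (Γ₀ y) - inner ℂ (Γ₀ x) (Γ₁ y)

/-- The operator `A_Θ`: the restriction of `B` to those `x` in its domain with `Γ x ∈ Θ`. -/
def boundaryRestriction (B : X →ₗ.[ℂ] (X × X)) (Γ : B.domain →ₗ[ℂ] G × G)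
    (Θ : Submodule ℂ (G × G)) : X →ₗ.[ℂ] (X × X) :=
  restrict B (Θ.comap Γ)

end RangeTriplet

end

namespace RangeTriplet

/-! ### Ranges of restrictions of an injective operator -/

section Operators

variable {E F V : Type*} [AddCommGroup E] [Module ℂ E] [AddCommGroup F] [Module ℂ F]
  [AddCommGroup V] [Module ℂ V]

/-! Coercivity makes `B` injective, so the boundary map descends to a surjection `T` from `K = ran
B` onto `G × G`, and `ran A_Θ` is the preimage of `Θ` under `T` (`ran_restrict_comap`). Parts (i)
and (iv) are then the correspondence between subspaces of `G × G` and subspaces of `K` containing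
`ker T`. Green's identity says that `T` preserves `bracket`, a nondegenerate form whose orthogonal
complements are adjoints. As `K` is closed, this makes `T` continuous (`continuous_of_bracket_eq`)
and hence open, so preimages commute with closures, giving (ii). For (iii), `H* = K` forces `H ⊆ ker
T`, and `adjoint_map_comap` computes the complement through `T`. -/

theorem mem_ran_iff {A : E →ₗ.[ℂ] F} {y : F} : y ∈ ran A ↔ ∃ x : A.domain, A x = y :=
  LinearMap.mem_range

theorem mem_ran_restrict_iff {A : E →ₗ.[ℂ] F} {D : Submodule ℂ A.domain} {y : F} :
    y ∈ ran (restrict A D) ↔ ∃ x ∈ D, A x = y := by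
  rw [mem_ran_iff]
  constructor
  · rintro ⟨⟨_, x, hx, rfl⟩, rfl⟩
    exact ⟨x, hx, rfl⟩
  · rintro ⟨x, hx, rfl⟩
    exact ⟨⟨x, x, hx, rfl⟩, rfl⟩

theorem restrict_le (A : E →ₗ.[ℂ] F) (D : Submodule ℂ A.domain) : restrict A D ≤ A := by
  refine ⟨Submodule.map_subtype_le _ _, fun x y h => ?_⟩
  have : Submodule.inclusion (Submodule.map_subtype_le A.domain D) x = y := Subtype.ext h
  rw [← this]
  rfl

/-- Restrictions of an injective operator are ordered like their ranges. -/
theorem le_of_ran_le {A C D : E →ₗ.[ℂ] F} (hA : Function.Injective A.toFun) (hC : C ≤ A)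
    (hD : D ≤ A) (h : ran C ≤ ran D) : C ≤ D := by
  have key : ∀ x : C.domain, ∃ y : D.domain, (x : E) = y ∧ C x = D y := by
    intro x
    obtain ⟨y, hy⟩ := mem_ran_iff.1 (h (mem_ran_iff.2 ⟨x, rfl⟩))
    obtain ⟨x', hx, hx'⟩ := LinearPMap.exists_of_le hC x
    obtain ⟨y', hy', hyy⟩ := LinearPMap.exists_of_le hD y
    have hxy : x' = y' := hA (show A x' = A y' by rw [← hx', ← hyy, hy])
    exact ⟨y, by rw [hx, hy', hxy], hy.symm⟩
  refine ⟨fun x hx => ?_, fun x y hxy => ?_⟩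
  · obtain ⟨y, hy, -⟩ := key ⟨x, hx⟩
    change x = y at hy
    rw [hy]
    exact y.2
  · obtain ⟨z, hz, hxz⟩ := key x
    rw [hxz, Subtype.ext (hz.symm.trans hxy : (z : E) = y)]

theorem ran_eq_iff_of_le {A C D : E →ₗ.[ℂ] F} (hA : Function.Injective A.toFun) (hC : C ≤ A)
    (hD : D ≤ A) : ran C = ran D ↔ C = D :=
  ⟨fun h => le_antisymm (le_of_ran_le hA hC hD h.le) (le_of_ran_le hA hD hC h.ge),
    fun h => h ▸ rfl⟩

/-- A linear map on the domain of an injective operator, transported to its range. -/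
noncomputable def onRan (A : E →ₗ.[ℂ] F) (hA : Function.Injective A.toFun) (Γ : A.domain →ₗ[ℂ] V) :
    ran A →ₗ[ℂ] V :=
  Γ ∘ₗ (LinearEquiv.ofInjective A.toFun hA).symm.toLinearMap

theorem onRan_apply (A : E →ₗ.[ℂ] F) (hA : Function.Injective A.toFun) (Γ : A.domain →ₗ[ℂ] V)
    (x : A.domain) (h : A x ∈ ran A) : onRan A hA Γ ⟨A x, h⟩ = Γ x := by
  have : (⟨A x, h⟩ : ran A) = LinearEquiv.ofInjective A.toFun hA x := rfl
  rw [this]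
  exact congrArg Γ ((LinearEquiv.ofInjective A.toFun hA).symm_apply_apply x)

theorem onRan_surjective {A : E →ₗ.[ℂ] F} (hA : Function.Injective A.toFun)
    {Γ : A.domain →ₗ[ℂ] V} (hΓ : Function.Surjective Γ) : Function.Surjective (onRan A hA Γ) :=
  hΓ.comp (LinearEquiv.ofInjective A.toFun hA).symm.surjective

theorem ran_restrict_comap {A : E →ₗ.[ℂ] F} (hA : Function.Injective A.toFun)
    (Γ : A.domain →ₗ[ℂ] V) (Θ : Submodule ℂ V) :
    ran (restrict A (Θ.comap Γ)) = (Θ.comap (onRan A hA Γ)).map (ran A).subtype := by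
  ext y
  rw [mem_ran_restrict_iff]
  constructor
  · rintro ⟨x, hx, rfl⟩
    refine ⟨⟨A x, mem_ran_iff.2 ⟨x, rfl⟩⟩, ?_, rfl⟩
    change onRan A hA Γ _ ∈ Θ
    rwa [onRan_apply]
  · rintro ⟨⟨y, hy⟩, hyΘ, rfl⟩
    obtain ⟨x, rfl⟩ := mem_ran_iff.1 hy
    change onRan A hA Γ _ ∈ Θ at hyΘ
    rw [onRan_apply] at hyΘ
    exact ⟨x, hyΘ, rfl⟩

end Operators

/-! ### Injectivity and closed range of the column operator -/

section Column

variable {X : Type*} [NormedAddCommGroup X] [InnerProductSpace ℂ X]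

theorem Coercive.injective {B : X →ₗ.[ℂ] (X × X)} (hB : Coercive B) :
    Function.Injective B.toFun := by
  obtain ⟨c, hc, h⟩ := hB
  rw [injective_iff_map_eq_zero]
  intro x hx
  have h0 : B x = 0 := hx
  have h1 := h x
  rw [h0, WithLp.toLp_zero, norm_zero] at h1
  have h2 : ‖(x : X)‖ ≤ 0 := nonpos_of_mul_nonpos_right h1 hc
  exact Subtype.ext (norm_le_zero_iff.1 h2)

/-- The range of a closed coercive operator is closed. -/
theorem Coercive.isClosed_ran [CompleteSpace X] {B : X →ₗ.[ℂ] (X × X)} (hB : Coercive B)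
    (hcl : B.IsClosed) : IsClosed (ran B : Set (X × X)) := by
  obtain ⟨c, hc, h⟩ := hB
  -- Coercivity uses the Hilbert norm, while `X × X` carries the sup norm; `‖L‖` pays for the
  -- change.
  set L : X × X →L[ℂ] WithLp 2 (X × X) :=
    (WithLp.prodContinuousLinearEquiv 2 ℂ X X).symm.toContinuousLinearMap
  have hL : ∀ x : B.domain, ‖(x : X)‖ ≤ ‖L‖ / c * ‖B x‖ := by
    intro x
    rw [div_mul_eq_mul_div, le_div_iff₀' hc]
    exact (h x).trans (L.le_opNorm (B x))
  let p : B.graph →L[ℂ] X × X := (ContinuousLinearMap.snd ℂ X (X × X)).comp B.graph.subtypeL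
  -- The graph norm is a maximum: `‖L‖ / c` controls the first component and `1` the second. So `p`
  -- is bounded below on a complete space.
  have hp : ∀ g : B.graph, ‖g‖ ≤ (max (‖L‖ / c) 1).toNNReal * ‖p g‖ := by
    rintro ⟨⟨x, y⟩, hg⟩
    obtain ⟨z, rfl, rfl⟩ := (LinearPMap.mem_graph_iff B).1 hg
    rw [Real.coe_toNNReal _ (zero_le_one.trans (le_max_right _ _))]
    change max ‖(z : X)‖ ‖B z‖ ≤ _ * ‖B z‖
    refine max_le ((hL z).trans ?_) (le_trans (one_mul _).ge ?_)
    · gcongr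
      exact le_max_left _ _
    · gcongr
      exact le_max_right _ _
  have : CompleteSpace B.graph :=
    IsClosed.completeSpace_coe (s := (B.graph : Set (X × X × X))) (hs := hcl)
  have hr := (p.antilipschitz_of_bound hp).isClosed_range p.uniformContinuous
  suffices h : (ran B : Set (X × X)) = Set.range p by
    rw [h]
    exact hr
  ext y
  rw [SetLike.mem_coe, mem_ran_iff]
  constructor
  · rintro ⟨x, rfl⟩
    exact ⟨⟨(x, B x), B.mem_graph x⟩, rfl⟩
  · rintro ⟨⟨⟨x, y⟩, hg⟩, rfl⟩
    obtain ⟨z, rfl, rfl⟩ := (LinearPMap.mem_graph_iff B).1 hg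
    exact ⟨z, rfl⟩

theorem mem_graph_column_iff {P S : X →ₗ.[ℂ] X} {x u v : X} :
    (x, u, v) ∈ (column P S).graph ↔ (x, u) ∈ P.graph ∧ (x, v) ∈ S.graph := by
  simp only [LinearPMap.mem_graph_iff]
  constructor
  · rintro ⟨z, rfl, hz⟩
    exact ⟨⟨⟨z, z.2.1⟩, rfl, congrArg Prod.fst hz⟩, ⟨⟨z, z.2.2⟩, rfl, congrArg Prod.snd hz⟩⟩
  · rintro ⟨⟨a, rfl, rfl⟩, ⟨b, hb, rfl⟩⟩
    obtain ⟨b, hb'⟩ := b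
    change b = _ at hb
    subst hb
    exact ⟨⟨a, a.2, hb'⟩, rfl, rfl⟩

theorem column_isClosed {P S : X →ₗ.[ℂ] X} (hP : P.IsClosed) (hS : S.IsClosed) :
    (column P S).IsClosed := by
  have h : ((column P S).graph : Set (X × X × X)) =
      (fun z => (z.1, z.2.1)) ⁻¹' (P.graph : Set (X × X)) ∩
        (fun z => (z.1, z.2.2)) ⁻¹' (S.graph : Set (X × X)) := by
    ext ⟨x, u, v⟩
    exact mem_graph_column_iff
  change IsClosed ((column P S).graph : Set (X × X × X))
  rw [h]
  exact (IsClosed.preimage (by fun_prop) hP).inter (IsClosed.preimage (by fun_prop) hS)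

end Column

/-! ### Continuity, closures and adjoints through the bracket -/

section Relations

variable {X : Type*} [NormedAddCommGroup X] [InnerProductSpace ℂ X]
variable {G : Type*} [NormedAddCommGroup G] [InnerProductSpace ℂ G]

/-- The indefinite sesquilinear form `⟪x₂, y₁⟫ - ⟪x₁, y₂⟫`, whose orthogonal complements are the
adjoints of linear relations. -/
noncomputable def bracket (x y : X × X) : ℂ := inner ℂ x.2 y.1 - inner ℂ x.1 y.2

theorem mem_adjoint_iff_bracket {K : Submodule ℂ (X × X)} {g : X × X} :
    g ∈ K.adjoint ↔ ∀ h ∈ K, bracket h g = 0 := by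
  rw [Submodule.mem_adjoint_iff]
  exact ⟨fun H h hh => H h.1 h.2 hh, fun H a b hab => H (a, b) hab⟩

theorem continuous_bracket_left (y : X × X) : Continuous fun x : X × X => bracket x y := by
  unfold bracket
  fun_prop

theorem eq_of_forall_bracket_eq {x x' : X × X} (h : ∀ y, bracket x y = bracket x' y) :
    x = x' := by
  refine Prod.ext (ext_inner_right ℂ fun v => ?_) (ext_inner_right ℂ fun v => ?_)
  · simpa [bracket] using h (0, v)
  · simpa [bracket] using h (v, 0)

variable {K : Submodule ℂ (X × X)} {T : K →ₗ[ℂ] G × G}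

/-- A boundary map is automatically continuous, by the closed graph theorem. -/
theorem continuous_of_bracket_eq [CompleteSpace X] [CompleteSpace G]
    (hK : IsClosed (K : Set (X × X))) (hT : Function.Surjective T)
    (hgreen : ∀ x y : K, bracket (x : X × X) y = bracket (T x) (T y)) : Continuous T := by
  have : CompleteSpace K := hK.completeSpace_coe
  apply T.continuous_of_isClosed_graph
  -- Surjectivity of `T` and nondegeneracy let the Green identity alone characterise the graph, by
  -- closed conditions.
  have h : (T.graph : Set (K × (G × G))) =
      ⋂ y : K, {z | bracket (z.1 : X × X) y = bracket z.2 (T y)} := by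
    ext ⟨x, g⟩
    simp only [SetLike.mem_coe, LinearMap.mem_graph_iff, Set.mem_iInter, Set.mem_ofPred_eq]
    constructor
    · rintro rfl y
      exact hgreen x y
    · intro h
      refine eq_of_forall_bracket_eq fun y => ?_
      obtain ⟨y, rfl⟩ := hT y
      rw [← h y, hgreen]
  rw [h]
  exact isClosed_iInter fun y => isClosed_eq
    ((continuous_bracket_left _).comp (continuous_subtype_val.comp continuous_fst))
    ((continuous_bracket_left _).comp continuous_snd)

/-- Preimages under a continuous open map commute with closure; since `K` is closed, closures in `K`
and in `X × X` agree. -/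
theorem topologicalClosure_map_comap [CompleteSpace X] [CompleteSpace G]
    (hK : IsClosed (K : Set (X × X))) (hT : Function.Surjective T) (hTc : Continuous T)
    (Θ : Submodule ℂ (G × G)) :
    ((Θ.comap T).map K.subtype).topologicalClosure =
      (Θ.topologicalClosure.comap T).map K.subtype := by
  have : CompleteSpace K := hK.completeSpace_coe
  have hopen : IsOpenMap T := ContinuousLinearMap.isOpenMap (⟨T, hTc⟩ : K →L[ℂ] G × G) hT
  apply SetLike.coe_injective
  change closure (Subtype.val '' (T ⁻¹' (Θ : Set (G × G)))) =
    Subtype.val '' (T ⁻¹' closure (Θ : Set (G × G)))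
  rw [hopen.preimage_closure_eq_closure_preimage hTc]
  exact hK.isClosedEmbedding_subtypeVal.closure_image_eq (T ⁻¹' (Θ : Set (G × G)))

/-- A boundary map for the adjoint of a symmetric relation intertwines the formation of
adjoints. -/
theorem adjoint_map_comap {H : Submodule ℂ (X × X)} (hH : H ≤ H.adjoint) (hHK : H.adjoint = K)
    (hT : Function.Surjective T)
    (hgreen : ∀ x y : K, bracket (x : X × X) y = bracket (T x) (T y)) (Θ : Submodule ℂ (G × G)) :
    ((Θ.comap T).map K.subtype).adjoint = (Θ.adjoint.comap T).map K.subtype := by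
  have hker : H ≤ (Θ.comap T).map K.subtype := by
    intro h hh
    have hhK : h ∈ K := hHK ▸ hH hh
    refine ⟨⟨h, hhK⟩, ?_, rfl⟩
    -- An element of `H` is bracket-orthogonal to `K = H*`, so its image is orthogonal to all of `G
    -- × G`.
    have h0 : T ⟨h, hhK⟩ = 0 := by
      refine eq_of_forall_bracket_eq fun y => ?_
      obtain ⟨y, rfl⟩ := hT y
      rw [← hgreen, mem_adjoint_iff_bracket.1 (hHK ▸ y.2) h hh]
      simp [bracket]
    change T _ ∈ Θ
    rw [h0]
    exact Θ.zero_mem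
  have hmem : ∀ g : K, (g : X × X) ∈ ((Θ.comap T).map K.subtype).adjoint ↔ T g ∈ Θ.adjoint := by
    intro g
    rw [mem_adjoint_iff_bracket, mem_adjoint_iff_bracket]
    constructor
    · intro hg θ hθ
      obtain ⟨h, rfl⟩ := hT θ
      rw [← hgreen]
      exact hg h ⟨h, hθ, rfl⟩
    · rintro hg _ ⟨h, hh, rfl⟩
      exact (hgreen h g).trans (hg _ hh)
  ext g
  constructor
  · intro hg
    -- Adjoints reverse inclusion, so `hker` places `g` in `H* = K`, where `T` is defined.
    have hgK : g ∈ K := by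
      rw [← hHK, mem_adjoint_iff_bracket]
      exact fun h hh => mem_adjoint_iff_bracket.1 hg h (hker hh)
    exact ⟨⟨g, hgK⟩, (hmem ⟨g, hgK⟩).1 hg, rfl⟩
  · rintro ⟨g, hg, rfl⟩
    exact (hmem g).2 hg

end Relations

/-! ### Subspaces between the kernel and the domain of a surjection -/

section Parametrization

variable {V W : Type*} [AddCommGroup V] [Module ℂ V] [AddCommGroup W] [Module ℂ W]
  {K : Submodule ℂ V} {T : K →ₗ[ℂ] W}

theorem map_comap_le_map_comap_iff (hT : Function.Surjective T) {Θ Θ' : Submodule ℂ W} :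
    (Θ.comap T).map K.subtype ≤ (Θ'.comap T).map K.subtype ↔ Θ ≤ Θ' := by
  rw [Submodule.map_le_map_iff_of_injective K.injective_subtype,
    Submodule.comap_le_comap_iff_of_surjective hT]

theorem map_comap_injective (hT : Function.Surjective T) :
    Function.Injective fun Θ : Submodule ℂ W => (Θ.comap T).map K.subtype :=
  (Submodule.map_injective_of_injective K.injective_subtype).comp
    (Submodule.comap_injective_of_surjective hT)

theorem exists_eq_map_comap {R : Submodule ℂ V}
    (hker : (LinearMap.ker T).map K.subtype ≤ R) (hR : R ≤ K) :
    ∃ Θ : Submodule ℂ W, R = (Θ.comap T).map K.subtype := by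
  refine ⟨(R.comap K.subtype).map T, ?_⟩
  rw [Submodule.comap_map_eq_self (Submodule.map_le_iff_le_comap.1 hker),
    Submodule.map_comap_subtype, inf_eq_right.2 hR]

end Parametrization

end RangeTriplet

/-- `LinearPMap.adjoint` is the adjoint of a densely defined operator; `Submodule.adjoint` is the
adjoint of a linear relation: `(g₁, g₂) ∈ K.adjoint` iff `⟪h₂, g₁⟫ = ⟪h₁, g₂⟫` for all
`(h₁, h₂) ∈ K`. Linear relations are linear subspaces of a product space. -/
theorem theorem2p10 {X : Type*} [NormedAddCommGroup X] [InnerProductSpace ℂ X] [CompleteSpace X]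
    {G : Type*} [NormedAddCommGroup G] [InnerProductSpace ℂ G] [CompleteSpace G]
    (P₀ S₀ : X →ₗ.[ℂ] X)
    (hP₀ : Dense (P₀.domain : Set X)) (hS₀ : Dense (S₀.domain : Set X))
    (B : X →ₗ.[ℂ] (X × X)) (hB : B = RangeTriplet.column P₀.adjoint S₀.adjoint)
    (hcoer : RangeTriplet.Coercive B)
    (H : Submodule ℂ (X × X)) (hH : H = RangeTriplet.kernelRelation P₀ S₀)
    (hsymm : H ≤ H.adjoint)
    (Γ₀ Γ₁ : B.domain →ₗ[ℂ] G) (hΓ : RangeTriplet.IsBoundaryTriplet B Γ₀ Γ₁)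
    (A : Submodule ℂ (G × G) → (X →ₗ.[ℂ] (X × X)))
    (hA : A = RangeTriplet.boundaryRestriction B (Γ₀.prod Γ₁)) :
    -- (i) parametrization of the intermediate relations and of the intermediate operators
    (∀ C : X →ₗ.[ℂ] (X × X),
      RangeTriplet.ran (RangeTriplet.restrict B (LinearMap.ker (Γ₀.prod Γ₁))) ≤
          RangeTriplet.ran C →
        RangeTriplet.ran C ≤ RangeTriplet.ran B →
          (∃! Θ : Submodule ℂ (G × G), RangeTriplet.ran C = RangeTriplet.ran (A Θ)) ∧
            (C ≤ B → ∃! Θ : Submodule ℂ (G × G), C = A Θ)) ∧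
    -- (ii) closures
    (∀ Θ : Submodule ℂ (G × G),
      (RangeTriplet.ran (A Θ)).topologicalClosure =
        RangeTriplet.ran (A Θ.topologicalClosure)) ∧
    -- (iii) adjoints; the identity `H* = ran B` does not follow from the other assumptions
    (H.adjoint = RangeTriplet.ran B →
      ∀ Θ : Submodule ℂ (G × G),
        (RangeTriplet.ran (A Θ)).adjoint = RangeTriplet.ran (A Θ.adjoint)) ∧
    -- (iv) monotonicity
    (∀ Θ Θ' : Submodule ℂ (G × G),
      RangeTriplet.ran (A Θ) ≤ RangeTriplet.ran (A Θ') ↔ Θ ≤ Θ') := by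
  subst hA
  have hinj : Function.Injective B.toFun := hcoer.injective
  have hcl : IsClosed (RangeTriplet.ran B : Set (X × X)) := by
    refine hcoer.isClosed_ran ?_
    rw [hB]
    exact RangeTriplet.column_isClosed (LinearPMap.adjoint_isClosed hP₀)
      (LinearPMap.adjoint_isClosed hS₀)
  set T := RangeTriplet.onRan B hinj (Γ₀.prod Γ₁) with hTdef
  have hT : Function.Surjective T := RangeTriplet.onRan_surjective hinj hΓ.surjective
  have hran : ∀ Θ : Submodule ℂ (G × G),
      RangeTriplet.ran (RangeTriplet.boundaryRestriction B (Γ₀.prod Γ₁) Θ) =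
        (Θ.comap T).map (RangeTriplet.ran B).subtype :=
    RangeTriplet.ran_restrict_comap hinj (Γ₀.prod Γ₁)
  have hgreen : ∀ x y : RangeTriplet.ran B,
      RangeTriplet.bracket (x : X × X) y = RangeTriplet.bracket (T x) (T y) := by
    rintro ⟨_, x, rfl⟩ ⟨_, y, rfl⟩
    have hx : T ⟨B.toFun x, x, rfl⟩ = (Γ₀ x, Γ₁ x) := RangeTriplet.onRan_apply B hinj _ x _
    have hy : T ⟨B.toFun y, y, rfl⟩ = (Γ₀ y, Γ₁ y) := RangeTriplet.onRan_apply B hinj _ y _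
    rw [hx, hy]
    exact hΓ.green x y
  refine ⟨fun C hC₀ hC => ?_, fun Θ => ?_, fun hHB Θ => ?_, fun Θ Θ' => ?_⟩
  -- The kernel is the preimage of the relation `⊥`.
  · have hker : RangeTriplet.ran (RangeTriplet.restrict B (LinearMap.ker (Γ₀.prod Γ₁))) =
        (LinearMap.ker T).map (RangeTriplet.ran B).subtype := hran ⊥
    obtain ⟨Θ, hΘ⟩ := RangeTriplet.exists_eq_map_comap (hker ▸ hC₀) hC
    have huniq : ∃! Θ : Submodule ℂ (G × G), RangeTriplet.ran C =
        RangeTriplet.ran (RangeTriplet.boundaryRestriction B (Γ₀.prod Γ₁) Θ) := by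
      refine ⟨Θ, hΘ.trans (hran Θ).symm, fun Θ' hΘ' => ?_⟩
      exact RangeTriplet.map_comap_injective hT ((hran Θ').symm.trans (hΘ'.symm.trans hΘ))
    refine ⟨huniq, fun hCB => ?_⟩
    have hiff : ∀ Θ : Submodule ℂ (G × G), C = RangeTriplet.boundaryRestriction B (Γ₀.prod Γ₁) Θ ↔
        RangeTriplet.ran C =
          RangeTriplet.ran (RangeTriplet.boundaryRestriction B (Γ₀.prod Γ₁) Θ) := fun Θ =>
      (RangeTriplet.ran_eq_iff_of_le hinj hCB (RangeTriplet.restrict_le B _)).symm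
    simpa only [hiff] using huniq
  · rw [hran, hran]
    exact RangeTriplet.topologicalClosure_map_comap hcl hT
      (RangeTriplet.continuous_of_bracket_eq hcl hT hgreen) Θ
  · rw [hran, hran]
    exact RangeTriplet.adjoint_map_comap hsymm hHB hT hgreen Θ
  · rw [hran, hran]
    exact RangeTriplet.map_comap_le_map_comap_iff hT
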